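/- Let $0<m<M$ and let $f:[0,M]\to\mathbb{R}$ be of class $C^1([0,M])$ with $f(0)=f(M)=0$, $f'(0)<0$ and $f>0$ in $(m,M)$. Set $F(s)=\int_0^s f(\sigma)\,d\sigma$ for $s\in[0,M]$, and assume that $F<0$ in $(0,m]$ and $F(M)>0$. Then there exist $c\in\mathbb{R}$ and a function $\varphi:\mathbb{R}\to(0,M)$ of class $C^2(\mathbb{R})$ such that $$\varphi''+c\,\varphi'+f(\varphi)=0\ \text{ in }\mathbb{R},\qquad \lim_{x\to-\infty}\varphi(x)=M,\qquad \lim_{x\to+\infty}\varphi(x)=0.$$ The speed $c$ is unique and the profile $\varphi$ is unique up to shifts: if $c'\in\mathbb{R}$ and $\psi:\mathbb{R}\to(0,M)$ of class $C^2(\mathbb{R})$ satisfy the same properties, then $c'=c$ and there is $\tau\in\mathbb{R}$ with $\psi(x)=\varphi(x+\tau)$ for all $x\in\mathbb{R}$. Furthermore, $c>0$ and $\varphi'<0$ in $\mathbb{R}$. -/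

import Mathlib

open Set Filter Topology

/-- `φ` is the profile of a traveling front with speed `c` connecting `M` (at `-∞`) and `0`
(at `+∞`) for the reaction term `f` on `[0, M]`: `φ : ℝ → (0, M)` is of class `C²` and solves
`φ'' + c φ' + f(φ) = 0` in `ℝ`. -/
structure IsFront (f : ℝ → ℝ) (M c : ℝ) (φ : ℝ → ℝ) : Prop where
  contDiff : ContDiff ℝ 2 φ
  mem_Ioo : ∀ x, φ x ∈ Ioo 0 M
  ode : ∀ x, deriv (deriv φ) x + c * deriv φ x + f (φ x) = 0
  tendsto_atBot : Tendsto φ atBot (𝓝 M)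
  tendsto_atTop : Tendsto φ atTop (𝓝 0)

/-! The problem is reduced to a first-order equation in the phase plane. If `φ' = -p(φ)`, the front
equation becomes `p' = c - g/p` on `(0, M)`, and `y = p²/2` solves `y' = c√(2y) - g` with `y(0) =
y(M) = 0`.

Existence is by shooting in `c` from `y(0) = 0`: `c = 0` gives `y(M) = -F(M) < 0`, while a large `c`
gives `y(M) ≥ 0`. The square root is not Lipschitz at `0`, so it is regularised and truncated first,
and a limit is taken by compactness (`IsBistable.exists_connection`). The resulting `p` vanishes at
most linearly at `0` and `M`, hence `∫ du/p` diverges at both ends and its inverse is a front on all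
of `ℝ` (`IsPhaseProfile.exists_isFront`).

For uniqueness, an energy argument makes every front strictly decreasing (`IsFront.deriv_neg`).
Along any front, the gap between `-φ'` and `p(φ)` satisfies a linear equation; times an integrating
factor it is monotone with limit `0` at both ends, hence zero (`IsFront.eq_of_isPhaseProfile`). This
identifies the speeds and leaves the autonomous equation `ψ' = -p(ψ)`. -/

/-- A continuous reaction term on `ℝ`, vanishing at `0` and `M`, of bistable type on `[0, M]`. -/
structure IsBistable (g : ℝ → ℝ) (m M : ℝ) : Prop where
  cont : Continuous g
  pos_m : 0 < m
  m_lt : m < M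
  zero_left : g 0 = 0
  zero_right : g M = 0
  pos : ∀ s ∈ Ioo m M, 0 < g s
  primitive_neg : ∀ s ∈ Ioc 0 m, (∫ σ in (0 : ℝ)..s, g σ) < 0
  primitive_pos : 0 < ∫ σ in (0 : ℝ)..M, g σ
  neg_near : ∀ᶠ s in 𝓝[>] 0, g s < 0
  lipschitz : ∃ L, ∀ s ∈ Icc 0 M, |g s| ≤ L * s ∧ |g s| ≤ L * (M - s)

namespace IsBistable

variable {g : ℝ → ℝ} {m M : ℝ}

lemma pos_M (hg : IsBistable g m M) : 0 < M := hg.pos_m.trans hg.m_lt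

lemma hasDerivAt_primitive (hg : IsBistable g m M) (u : ℝ) :
    HasDerivAt (fun s => ∫ σ in (0 : ℝ)..s, g σ) (g u) u :=
  intervalIntegral.integral_hasDerivAt_right (hg.cont.intervalIntegrable _ _)
    hg.cont.stronglyMeasurable.stronglyMeasurableAtFilter hg.cont.continuousAt

end IsBistable

/-! ### Limits at infinity. -/

/-- If `φ` converges at `+∞` and `φ'' + c φ' → 0`, then `φ' → 0`. -/
lemma tendsto_deriv_atTop_of_tendsto {φ φ' φ'' : ℝ → ℝ} {c l : ℝ}
    (h₁ : ∀ x, HasDerivAt φ (φ' x) x) (h₂ : ∀ x, HasDerivAt φ' (φ'' x) x)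
    (hφ : Tendsto φ atTop (𝓝 l)) (h : Tendsto (fun x => φ'' x + c * φ' x) atTop (𝓝 0)) :
    Tendsto φ' atTop (𝓝 0) := by
  rw [Metric.tendsto_atTop] at hφ h ⊢
  intro ε hε
  set η := ε / (4 + 2 * |c|) with hη
  have hden : 0 < 4 + 2 * |c| := by positivity
  have hηpos : 0 < η := by positivity
  obtain ⟨X₁, hX₁⟩ := hφ η hηpos
  obtain ⟨X₂, hX₂⟩ := h η hηpos
  refine ⟨max X₁ X₂, fun x hx => ?_⟩
  have hx₁ : X₁ ≤ x := (le_max_left _ _).trans hx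
  have hx₂ : X₂ ≤ x := (le_max_right _ _).trans hx
  have hx1 : x < x + 1 := by linarith
  -- The mean value theorem makes `φ'` small at some `ξ` in `(x, x + 1)`; applied to `φ' + c φ`, it
  -- carries the smallness back to `x`. The total error is `(3 + 2|c|) η < ε`.
  obtain ⟨ξ, hξ, hξ'⟩ := exists_hasDerivAt_eq_slope φ φ' hx1
    (fun y _ => (h₁ y).continuousAt.continuousWithinAt) (fun y _ => h₁ y)
  obtain ⟨ζ, hζ, hζ'⟩ := exists_hasDerivAt_eq_slope (fun y => φ' y + c * φ y)
    (fun y => φ'' y + c * φ' y) hξ.1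
    (fun y _ => ((h₂ y).add ((h₁ y).const_mul c)).continuousAt.continuousWithinAt)
    (fun y _ => (h₂ y).add ((h₁ y).const_mul c))
  have a1 := hX₁ x hx₁
  have a2 := hX₁ (x + 1) (by linarith)
  have a3 := hX₁ ξ (by linarith [hξ.1])
  have a4 := hX₂ ζ (by linarith [hζ.1])
  rw [Real.dist_eq] at *
  have hξx : 0 < ξ - x := by linarith [hξ.1]
  rw [eq_div_iff hξx.ne'] at hζ'
  have e1 : φ' ξ = φ (x + 1) - φ x := by rw [hξ']; ring
  have b1 : |φ' ξ| ≤ 2 * η := by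
    rw [e1, abs_le]; rw [abs_lt] at a1 a2; constructor <;> linarith
  have b2 : |φ ξ - φ x| ≤ 2 * η := by
    rw [abs_le]; rw [abs_lt] at a1 a3; constructor <;> linarith
  have b3 : |(φ'' ζ + c * φ' ζ) * (ξ - x)| ≤ η := by
    rw [abs_mul, abs_of_pos hξx]
    rw [sub_zero] at a4
    nlinarith [hξ.2, abs_nonneg (φ'' ζ + c * φ' ζ)]
  have e2 : φ' x - 0 = φ' ξ - (φ'' ζ + c * φ' ζ) * (ξ - x) + c * (φ ξ - φ x) := by
    rw [hζ']; ring
  have b4 : |c * (φ ξ - φ x)| ≤ |c| * (2 * η) := by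
    rw [abs_mul]; gcongr
  have e3 : ε = (4 + 2 * |c|) * η := by rw [hη]; field_simp
  calc |φ' x - 0| ≤ |φ' ξ| + |(φ'' ζ + c * φ' ζ) * (ξ - x)| + |c * (φ ξ - φ x)| := by
        rw [e2]; exact (abs_add_le _ _).trans (by gcongr; exact abs_sub _ _)
    _ ≤ 2 * η + η + |c| * (2 * η) := by gcongr
    _ < ε := by rw [e3]; linarith

/-- If `φ` converges at `-∞` and `φ'' + c φ' → 0`, then `φ' → 0`. -/
lemma tendsto_deriv_atBot_of_tendsto {φ φ' φ'' : ℝ → ℝ} {c l : ℝ}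
    (h₁ : ∀ x, HasDerivAt φ (φ' x) x) (h₂ : ∀ x, HasDerivAt φ' (φ'' x) x)
    (hφ : Tendsto φ atBot (𝓝 l)) (h : Tendsto (fun x => φ'' x + c * φ' x) atBot (𝓝 0)) :
    Tendsto φ' atBot (𝓝 0) := by
  have key : Tendsto (fun x => -φ' (-x)) atTop (𝓝 0) := by
    refine tendsto_deriv_atTop_of_tendsto (φ := fun x => φ (-x)) (φ'' := fun x => φ'' (-x))
      (c := -c) (l := l) (fun x => ?_) (fun x => ?_) (hφ.comp tendsto_neg_atTop_atBot) ?_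
    · simpa [Function.comp_def] using (h₁ (-x)).comp x (hasDerivAt_neg x)
    · exact ((h₂ (-x)).comp x (hasDerivAt_neg x)).neg.congr_deriv (by ring)
    · refine (h.comp tendsto_neg_atTop_atBot).congr fun x => ?_
      simp
  have := (key.comp tendsto_neg_atBot_atTop).neg
  simpa [Function.comp_def] using this

/-- A function that is antitone and tends to the same limit at `-∞` and `+∞` is constant. -/
lemma Antitone.eq_of_tendsto {D : ℝ → ℝ} {l : ℝ} (hD : Antitone D)
    (hb : Tendsto D atBot (𝓝 l)) (ht : Tendsto D atTop (𝓝 l)) (x : ℝ) : D x = l :=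
  le_antisymm (hD.ge_of_tendsto hb x) (hD.le_of_tendsto ht x)

/-! ### Energy and monotonicity of fronts. -/

namespace IsFront

variable {f g : ℝ → ℝ} {m M c : ℝ} {φ : ℝ → ℝ}

/-- A front takes its values in `(0, M)`, so the reaction term may be replaced by a continuous
extension to `ℝ`. -/
lemma congr (h : IsFront f M c φ) (hfg : ∀ s ∈ Ioo 0 M, f s = g s) : IsFront g M c φ :=
  ⟨h.contDiff, h.mem_Ioo, fun x => by rw [← hfg _ (h.mem_Ioo x)]; exact h.ode x,
    h.tendsto_atBot, h.tendsto_atTop⟩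

lemma hasDerivAt (h : IsFront f M c φ) (x : ℝ) : HasDerivAt φ (deriv φ x) x :=
  (h.contDiff.differentiable (by norm_num) x).hasDerivAt

lemma hasDerivAt_deriv (h : IsFront f M c φ) (x : ℝ) :
    HasDerivAt (deriv φ) (-c * deriv φ x - f (φ x)) x := by
  have h1 : ContDiff ℝ 1 (deriv φ) :=
    (contDiff_succ_iff_deriv.1 (show ContDiff ℝ (1 + 1) φ from h.contDiff)).2.2
  have := (h1.differentiable (by norm_num) x).hasDerivAt
  have e := h.ode x
  rwa [show deriv (deriv φ) x = -c * deriv φ x - f (φ x) by linarith] at this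

lemma continuous (h : IsFront f M c φ) : Continuous φ := h.contDiff.continuous

lemma tendsto_deriv_atTop (h : IsFront g M c φ) (hg : IsBistable g m M) :
    Tendsto (deriv φ) atTop (𝓝 0) := by
  refine tendsto_deriv_atTop_of_tendsto (c := c) h.hasDerivAt h.hasDerivAt_deriv h.tendsto_atTop ?_
  have := ((hg.cont.tendsto 0).comp h.tendsto_atTop).neg
  rw [hg.zero_left, neg_zero] at this
  exact this.congr fun x => by simp only [Function.comp_apply]; ring

lemma tendsto_deriv_atBot (h : IsFront g M c φ) (hg : IsBistable g m M) :
    Tendsto (deriv φ) atBot (𝓝 0) := by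
  refine tendsto_deriv_atBot_of_tendsto (c := c) h.hasDerivAt h.hasDerivAt_deriv h.tendsto_atBot ?_
  have := ((hg.cont.tendsto M).comp h.tendsto_atBot).neg
  rw [hg.zero_right, neg_zero] at this
  exact this.congr fun x => by simp only [Function.comp_apply]; ring

/-- The mechanical energy of a front is nonnegative. -/
lemma energy_nonneg (h : IsFront g M c φ) (hg : IsBistable g m M) (x : ℝ) :
    0 ≤ deriv φ x ^ 2 / 2 + ∫ σ in (0 : ℝ)..φ x, g σ := by
  set F : ℝ → ℝ := fun s => ∫ σ in (0 : ℝ)..s, g σ with hF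
  set E : ℝ → ℝ := fun x => deriv φ x ^ 2 / 2 + F (φ x) with hE
  have hFc : Continuous F :=
    continuous_iff_continuousAt.2 fun u => (hg.hasDerivAt_primitive u).continuousAt
  have hE' : ∀ x, HasDerivAt E (-c * deriv φ x ^ 2) x := fun x => by
    have h1 := (((h.hasDerivAt_deriv x).pow 2).div_const 2).add
      ((hg.hasDerivAt_primitive (φ x)).comp x (h.hasDerivAt x))
    refine HasDerivAt.congr_deriv (f := E) h1 ?_
    norm_num
    ring
  have htop : Tendsto E atTop (𝓝 0) := by
    have := (((h.tendsto_deriv_atTop hg).pow 2).div_const 2).add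
      ((hFc.tendsto 0).comp h.tendsto_atTop)
    simpa [hF] using this
  have hbot : Tendsto E atBot (𝓝 (F M)) := by
    have := (((h.tendsto_deriv_atBot hg).pow 2).div_const 2).add
      ((hFc.tendsto M).comp h.tendsto_atBot)
    simpa using this
  have hEd : Differentiable ℝ E := fun x => (hE' x).differentiableAt
  -- Since `E' = -c φ'²`, a speed `c ≤ 0` would make `E` nondecreasing from `F M > 0` to `0`, which
  -- is absurd. Otherwise `E` decreases to `0`.
  rcases le_total c 0 with hc | hc
  · have hmono : Monotone E := monotone_of_deriv_nonneg hEd fun x => by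
      rw [(hE' x).deriv]; nlinarith [sq_nonneg (deriv φ x)]
    have h1 := hmono.le_of_tendsto hbot 0
    have h2 := hmono.ge_of_tendsto htop 0
    have h3 : 0 < F M := hg.primitive_pos
    linarith
  · have hanti : Antitone E := antitone_of_deriv_nonpos hEd fun x => by
      rw [(hE' x).deriv]; nlinarith [sq_nonneg (deriv φ x)]
    exact hanti.le_of_tendsto htop x

/-- Every front is strictly decreasing. -/
theorem deriv_neg (h : IsFront g M c φ) (hg : IsBistable g m M) (x : ℝ) : deriv φ x < 0 := by
  -- At a critical point the energy is `F(φ) ≥ 0`, which forces `φ > m` and so `φ'' = -g(φ) < 0`.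
  -- Thus `φ'` can cross zero only downwards.
  have crit : ∀ y, deriv φ y = 0 → -c * deriv φ y - g (φ y) < 0 := fun y hy => by
    have hE := h.energy_nonneg hg y
    rw [hy] at hE ⊢
    have hm : m < φ y := by
      by_contra! hle
      have := hg.primitive_neg (φ y) ⟨(h.mem_Ioo y).1, hle⟩
      norm_num at hE
      linarith
    have := hg.pos (φ y) ⟨hm, (h.mem_Ioo y).2⟩
    linarith
  have nonpos : ∀ y, deriv φ y ≤ 0 := fun y => by
    obtain ⟨z, hz, hzy⟩ : ∃ z, φ y < φ z ∧ z < y :=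
      ((h.tendsto_atBot.eventually (lt_mem_nhds (h.mem_Ioo y).2)).and
        (eventually_lt_atBot y)).exists
    obtain ⟨b, hb, hb'⟩ := exists_hasDerivAt_eq_slope φ (deriv φ) hzy
      h.continuous.continuousOn (fun w _ => h.hasDerivAt w)
    have hb0 : deriv φ b ≤ 0 := by
      rw [hb']; exact div_nonpos_of_nonpos_of_nonneg (by linarith) (by linarith)
    exact image_le_of_deriv_right_lt_deriv_boundary (B := fun _ => 0) (B' := fun _ => 0)
      (fun w _ => (h.hasDerivAt_deriv w).continuousAt.continuousWithinAt)
      (fun w _ => (h.hasDerivAt_deriv w).hasDerivWithinAt) hb0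
      (fun w => hasDerivAt_const w 0) (fun w _ hw => crit w hw) ⟨hb.2.le, le_rfl⟩
  refine lt_of_le_of_ne (nonpos x) fun hx => ?_
  have hmax : IsLocalMax (deriv φ) x := Eventually.of_forall fun y => by rw [hx]; exact nonpos y
  exact (crit x hx).ne (hmax.hasDerivAt_eq_zero (h.hasDerivAt_deriv x))

end IsFront

/-! ### Phase profiles and uniqueness. -/

/-- A trajectory of a front in the phase plane, seen as a graph over `[0, M]`: for a front `φ` of
speed `c`, the function `p` such that `φ' = -p ∘ φ` is one. -/
structure IsPhaseProfile (g : ℝ → ℝ) (M c : ℝ) (p : ℝ → ℝ) : Prop where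
  cont : Continuous p
  zero_left : p 0 = 0
  zero_right : p M = 0
  pos : ∀ u ∈ Ioo 0 M, 0 < p u
  hasDerivAt : ∀ u ∈ Ioo 0 M, HasDerivAt p (c - g u / p u) u

namespace IsFront

variable {g p φ : ℝ → ℝ} {m M c c' : ℝ}

/-- The phase portrait of a front coincides with any given phase profile, and so do the speeds. -/
theorem eq_of_isPhaseProfile (h : IsFront g M c' φ) (hg : IsBistable g m M)
    (hp : IsPhaseProfile g M c p) : c' = c ∧ ∀ x, deriv φ x = -p (φ x) := by
  have hr : ∀ x, 0 < p (φ x) := fun x => hp.pos _ (h.mem_Ioo x)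
  have hq := h.deriv_neg hg
  set k : ℝ → ℝ := fun x => g (φ x) / p (φ x) with hk
  have hkc : Continuous k :=
    (hg.cont.comp h.continuous).div (hp.cont.comp h.continuous) fun x => (hr x).ne'
  set H : ℝ → ℝ := fun x => ∫ t in (0 : ℝ)..x, k t with hH
  have hH' : ∀ x, HasDerivAt H (k x) x := fun x =>
    intervalIntegral.integral_hasDerivAt_right (hkc.intervalIntegrable _ _)
      hkc.stronglyMeasurable.stronglyMeasurableAtFilter hkc.continuousAt
  -- The gap obeys `d' = (c' - c) φ' - k d`, for which `exp H` is an integrating factor.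
  set d : ℝ → ℝ := fun x => -deriv φ x - p (φ x) with hd
  set D : ℝ → ℝ := fun x => d x * Real.exp (H x) with hDdef
  have hd' : ∀ x, HasDerivAt d ((c' - c) * deriv φ x - k x * d x) x := fun x => by
    have h1 := (h.hasDerivAt_deriv x).neg.sub
      ((hp.hasDerivAt _ (h.mem_Ioo x)).comp x (h.hasDerivAt x))
    refine HasDerivAt.congr_deriv (f := d) h1 ?_
    have := (hr x).ne'
    simp only [hd, hk]
    field_simp
    ring
  have hD' : ∀ x, HasDerivAt D ((c' - c) * (deriv φ x * Real.exp (H x))) x := fun x => by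
    exact HasDerivAt.congr_deriv (f := D) ((hd' x).mul (hH' x).exp) (by ring)
  have hHd : Differentiable ℝ H := fun x => (hH' x).differentiableAt
  have hDd : Differentiable ℝ D := fun x => (hD' x).differentiableAt
  have hdbot : Tendsto d atBot (𝓝 0) := by
    have := (h.tendsto_deriv_atBot hg).neg.sub ((hp.cont.tendsto M).comp h.tendsto_atBot)
    simpa [hp.zero_right] using this
  have hdtop : Tendsto d atTop (𝓝 0) := by
    have := (h.tendsto_deriv_atTop hg).neg.sub ((hp.cont.tendsto 0).comp h.tendsto_atTop)
    simpa [hp.zero_left] using this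
  -- Near `-∞` the front lies in `(m, M)`, where `g > 0`: `H` increases there, so `exp H` stays
  -- bounded. Near `+∞` the sign `g < 0` close to `0` plays the same role.
  have hDbot : Tendsto D atBot (𝓝 0) := by
    obtain ⟨X, hX⟩ := eventually_atBot.1 (h.tendsto_atBot.eventually (lt_mem_nhds hg.m_lt))
    have hmono : MonotoneOn H (Iic X) := by
      refine monotoneOn_of_deriv_nonneg (convex_Iic X) hHd.continuous.continuousOn
        hHd.differentiableOn fun x hx => ?_
      rw [interior_Iic] at hx
      rw [(hH' x).deriv]
      exact (div_pos (hg.pos _ ⟨hX x (le_of_lt hx), (h.mem_Ioo x).2⟩) (hr x)).le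
    refine hdbot.zero_mul_isBoundedUnder_le ⟨Real.exp (H X), ?_⟩
    rw [eventually_map]
    filter_upwards [eventually_le_atBot X] with x hx
    simp only [Function.comp_apply, Real.norm_eq_abs, Real.abs_exp]
    exact Real.exp_le_exp.2 (hmono hx self_mem_Iic hx)
  have hDtop : Tendsto D atTop (𝓝 0) := by
    have hφ0 : Tendsto φ atTop (𝓝[>] 0) :=
      tendsto_nhdsWithin_iff.2 ⟨h.tendsto_atTop, Eventually.of_forall fun x => (h.mem_Ioo x).1⟩
    obtain ⟨X, hX⟩ := eventually_atTop.1 (hφ0.eventually hg.neg_near)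
    have hanti : AntitoneOn H (Ici X) := by
      refine antitoneOn_of_deriv_nonpos (convex_Ici X) hHd.continuous.continuousOn
        hHd.differentiableOn fun x hx => ?_
      rw [interior_Ici] at hx
      rw [(hH' x).deriv]
      exact (div_neg_of_neg_of_pos (hX x (le_of_lt hx)) (hr x)).le
    refine hdtop.zero_mul_isBoundedUnder_le ⟨Real.exp (H X), ?_⟩
    rw [eventually_map]
    filter_upwards [eventually_ge_atTop X] with x hx
    simp only [Function.comp_apply, Real.norm_eq_abs, Real.abs_exp]
    exact Real.exp_le_exp.2 (hanti self_mem_Ici hx hx)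
  have hneg : ∀ x, deriv φ x * Real.exp (H x) < 0 := fun x =>
    mul_neg_of_neg_of_pos (hq x) (Real.exp_pos _)
  have hD0 : ∀ x, D x = 0 := by
    -- `D'` has the constant sign of `c - c'`, so `D` is monotone in either case.
    rcases le_total c' c with hcc | hcc
    · have : Antitone (-D) := by
        refine antitone_of_deriv_nonpos hDd.neg fun x => ?_
        rw [(hD' x).neg.deriv]
        nlinarith [hneg x]
      intro x
      have := this.eq_of_tendsto (l := -0) hDbot.neg hDtop.neg x
      simpa using this
    · have : Antitone D := by
        refine antitone_of_deriv_nonpos hDd fun x => ?_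
        rw [(hD' x).deriv]
        nlinarith [hneg x]
      exact this.eq_of_tendsto hDbot hDtop
  constructor
  · have h0 : HasDerivAt D 0 0 := by
      rw [funext hD0]; exact hasDerivAt_const _ _
    have := (hD' 0).unique h0
    rcases mul_eq_zero.1 this with h1 | h1
    · linarith
    · exact absurd h1 (hneg 0).ne
  · intro x
    have : d x = 0 := (mul_eq_zero.1 (hD0 x)).resolve_right (Real.exp_pos _).ne'
    simp only [hd] at this
    linarith

end IsFront

/-! ### Shooting for a Lipschitz phase-plane equation. -/

/-- Global existence on `[0, b]` for a bounded, globally Lipschitz vector field. -/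
lemma exists_isIntegralCurveOn_Icc {v : ℝ → ℝ → ℝ} {K : NNReal} {L b : ℝ} (hb : 0 ≤ b)
    (hv : ∀ t, LipschitzWith K (v t)) (hc : ∀ y, Continuous (v · y))
    (hL : ∀ t ∈ Icc 0 b, ∀ y, |v t y| ≤ L) :
    ∃ y : ℝ → ℝ, y 0 = 0 ∧ IsIntegralCurveOn y v (Icc 0 b) := by
  have hL0 : 0 ≤ L := (abs_nonneg _).trans (hL 0 ⟨le_rfl, hb⟩ 0)
  -- A curve of speed at most `L` stays in the ball of radius `L * b` up to time `b`, so
  -- Picard–Lindelöf covers the whole interval at once.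
  have hPL : IsPicardLindelof v (tmin := 0) (tmax := b) ⟨0, le_rfl, hb⟩ 0
      (L.toNNReal * b.toNNReal) 0 L.toNNReal K :=
    { lipschitzOnWith := fun t _ => (hv t).lipschitzOnWith
      continuousOn := fun y _ => (hc y).continuousOn
      norm_le := fun t ht y _ => (hL t ht y).trans (Real.le_coe_toNNReal L)
      mul_max_le := by simp [hb, hL0] }
  exact hPL.exists_eq_forall_mem_Icc_hasDerivWithinAt₀

/-- The vector field of the phase-plane equation, with `h` in the place of `y ↦ √(2 y)`. -/
def phaseField (h g : ℝ → ℝ) (c t y : ℝ) : ℝ := c * h y - g t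

section PhaseField

variable {h g : ℝ → ℝ} {B G M c C : ℝ} {K : NNReal} {y : ℝ → ℝ}

lemma lipschitzWith_phaseField (hh : LipschitzWith K h) (c t : ℝ) :
    LipschitzWith (‖c‖₊ * K) (phaseField h g c t) := by
  refine LipschitzWith.of_dist_le_mul fun x z => ?_
  have := hh.dist_le_mul x z
  simp only [phaseField, Real.dist_eq, NNReal.coe_mul, coe_nnnorm, Real.norm_eq_abs] at *
  rw [show c * h x - g t - (c * h z - g t) = c * (h x - h z) by ring, abs_mul, mul_assoc]
  gcongr

lemma abs_phaseField_le (hB : ∀ z, h z ∈ Icc 0 B) (hG : ∀ t ∈ Icc 0 M, |g t| ≤ G)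
    (hc : c ∈ Icc 0 C) {t : ℝ} (ht : t ∈ Icc 0 M) (z : ℝ) : |phaseField h g c t z| ≤ C * B + G := by
  have h1 : |c * h z| ≤ C * B := by
    rw [abs_of_nonneg (mul_nonneg hc.1 (hB z).1)]
    exact mul_le_mul hc.2 (hB z).2 (hB z).1 (hc.1.trans hc.2)
  exact (abs_sub _ _).trans (add_le_add h1 (hG t ht))

lemma IsIntegralCurveOn.eq_integral (hy : IsIntegralCurveOn y (phaseField h g c) (Icc 0 M))
    (hh : Continuous h) (hg : Continuous g) (h0 : y 0 = 0) {t : ℝ} (ht : t ∈ Icc 0 M) :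
    y t = ∫ s in (0 : ℝ)..t, phaseField h g c s (y s) := by
  have hsub : Icc 0 t ⊆ Icc 0 M := Icc_subset_Icc_right ht.2
  have hyc : ContinuousOn y (Icc 0 t) := hy.continuousOn.mono hsub
  rw [intervalIntegral.integral_eq_sub_of_hasDerivAt_of_le ht.1 hyc, h0, sub_zero]
  · intro s hs
    exact (hy s (hsub (Ioo_subset_Icc_self hs))).hasDerivAt
      (Icc_mem_nhds hs.1 (hs.2.trans_le ht.2))
  · refine ContinuousOn.intervalIntegrable ?_
    rw [uIcc_of_le ht.1]
    exact ((hh.comp_continuousOn hyc).const_smul c).sub hg.continuousOn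

/-- Shooting in the speed for the phase-plane equation with a Lipschitz nonlinearity. -/
lemma exists_phaseField_connection (hM : 0 ≤ M) (hC : 0 ≤ C) (hh : LipschitzWith K h)
    (hB : ∀ z, h z ∈ Icc 0 B) (hg : Continuous g) (hG : ∀ t ∈ Icc 0 M, |g t| ≤ G)
    (hgM : 0 ≤ ∫ s in (0 : ℝ)..M, g s)
    (hhigh : ∀ y : ℝ → ℝ, y 0 = 0 → IsIntegralCurveOn y (phaseField h g C) (Icc 0 M) → 0 ≤ y M) :
    ∃ c ∈ Icc 0 C, ∃ y : ℝ → ℝ, y 0 = 0 ∧ y M = 0 ∧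
      IsIntegralCurveOn y (phaseField h g c) (Icc 0 M) := by
  have hex : ∀ c : ℝ, ∃ y : ℝ → ℝ, y 0 = 0 ∧ IsIntegralCurveOn y (phaseField h g c) (Icc 0 M) :=
    fun c => by
      refine exists_isIntegralCurveOn_Icc (L := |c| * B + G) hM (lipschitzWith_phaseField hh c)
        (fun z => continuous_const.sub hg) fun t ht z => ?_
      refine (abs_sub _ _).trans (add_le_add ?_ (hG t ht))
      rw [abs_mul, abs_of_nonneg (hB z).1]
      exact mul_le_mul_of_nonneg_left (hB z).2 (abs_nonneg c)
  choose Y hY0 hY using hex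
  have hright : ∀ c, ∀ t ∈ Ico 0 M,
      HasDerivWithinAt (Y c) (phaseField h g c t (Y c t)) (Ici t) t := fun c t ht =>
    (hY c t (Ico_subset_Icc_self ht)).mono_of_mem_nhdsWithin (Icc_mem_nhdsGE_of_mem ht)
  have hcont : Continuous fun c => Y c M := by
    refine continuous_iff_continuousAt.2 fun c₀ => ?_
    -- `Y c` solves the equation of speed `c₀` up to a defect `|c - c₀| * B`, and Grönwall's
    -- inequality applies.
    have hbound : ∀ c, dist (Y c M) (Y c₀ M) ≤
        gronwallBound 0 (‖c₀‖₊ * K : NNReal) (|c - c₀| * B + 0) M := fun c => by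
      have := dist_le_of_approx_trajectories_ODE (εf := |c - c₀| * B) (εg := 0) (δ := 0)
        (lipschitzWith_phaseField (g := g) hh c₀)
        (hY c).continuousOn (hright c) (fun t _ => ?_) (hY c₀).continuousOn (hright c₀)
        (fun t _ => (dist_self _).le) (by rw [hY0, hY0, dist_self]) M ⟨hM, le_rfl⟩
      · simpa using this
      · rw [Real.dist_eq, phaseField, phaseField,
          show c * h (Y c t) - g t - (c₀ * h (Y c t) - g t) = (c - c₀) * h (Y c t) by ring, abs_mul,
          abs_of_nonneg (hB _).1]
        exact mul_le_mul_of_nonneg_left (hB _).2 (abs_nonneg _)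
    rw [ContinuousAt, tendsto_iff_dist_tendsto_zero]
    refine squeeze_zero (fun _ => dist_nonneg) hbound ?_
    have hlim : Continuous fun c => gronwallBound 0 (‖c₀‖₊ * K : NNReal) (|c - c₀| * B + 0) M :=
      (gronwallBound_continuous_ε _ _ _).comp (by fun_prop)
    have := hlim.tendsto c₀
    simpa [gronwallBound_ε0_δ0] using this
  have hlow : Y 0 M ≤ 0 := by
    rw [(hY 0).eq_integral hh.continuous hg (hY0 0) ⟨hM, le_rfl⟩]
    simpa [phaseField] using hgM
  obtain ⟨c, hc, hcM⟩ := intermediate_value_Icc hC hcont.continuousOn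
    ⟨hlow, hhigh (Y C) (hY0 C) (hY C)⟩
  exact ⟨c, hc, Y c, hY0 c, hcM, hY c⟩

end PhaseField

/-! ### The regularised square root. -/

/-- A Lipschitz approximation of `z ↦ √(2 z⁺)`, truncated at height `R`. -/
noncomputable def truncSqrt (R ε z : ℝ) : ℝ := √(2 * min (max z 0) R + ε)

section TruncSqrt

variable {R ε z : ℝ}

lemma continuous_truncSqrt (R ε : ℝ) : Continuous (truncSqrt R ε) := by
  unfold truncSqrt; fun_prop

lemma truncSqrt_zero_of_nonpos (hR : 0 ≤ R) (hz : z ≤ 0) : truncSqrt R 0 z = 0 := by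
  simp [truncSqrt, max_eq_right hz, min_eq_left hR]

lemma truncSqrt_zero_of_mem (hz : z ∈ Icc 0 R) : truncSqrt R 0 z = √(2 * z) := by
  simp [truncSqrt, max_eq_left hz.1, min_eq_left hz.2]

lemma truncSqrt_mem_Icc {B : ℝ} (hB : 0 ≤ B) (hRB : 2 * R + 1 ≤ B ^ 2) (hε : ε ≤ 1) :
    truncSqrt R ε z ∈ Icc 0 B := by
  refine ⟨Real.sqrt_nonneg _, Real.sqrt_le_iff.2 ⟨hB, ?_⟩⟩
  linarith [min_le_right (max z 0) R]

lemma sqrt_le_truncSqrt {w : ℝ} (hε : 0 ≤ ε) (hwz : w ≤ z) (hwR : w ≤ R) :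
    √(2 * w) ≤ truncSqrt R ε z := by
  refine Real.sqrt_le_sqrt ?_
  have := le_min (hwz.trans (le_max_left z 0)) hwR
  linarith

/-- Multiply by the conjugate sum, which is at least `√ε`. The constant blows up as `ε → 0`, so the
later limit must rely on bounds on the values alone. -/
lemma lipschitzWith_truncSqrt (hR : 0 ≤ R) (hε : 0 < ε) :
    LipschitzWith (2 / √ε).toNNReal (truncSqrt R ε) := by
  refine LipschitzWith.of_dist_le_mul fun x z => ?_
  have hcl := ((LipschitzWith.id (α := ℝ)).max_const 0).min_const R |>.dist_le_mul x z
  have hse : 0 < √ε := Real.sqrt_pos.2 hε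
  rw [Real.coe_toNNReal _ (by positivity), div_mul_eq_mul_div, le_div_iff₀ hse]
  simp only [Real.dist_eq, NNReal.coe_one, one_mul, id] at *
  unfold truncSqrt
  set a := min (max x 0) R with ha
  set b := min (max z 0) R with hb
  have ha0 : 0 ≤ a := le_min (le_max_right _ _) hR
  have hb0 : 0 ≤ b := le_min (le_max_right _ _) hR
  have h1 : √ε ≤ √(2 * a + ε) + √(2 * b + ε) :=
    (Real.sqrt_le_sqrt (by linarith)).trans (le_add_of_nonneg_right (Real.sqrt_nonneg _))
  calc |√(2 * a + ε) - √(2 * b + ε)| * √ε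
      ≤ |√(2 * a + ε) - √(2 * b + ε)| * (√(2 * a + ε) + √(2 * b + ε)) := by gcongr
    _ = |(√(2 * a + ε) - √(2 * b + ε)) * (√(2 * a + ε) + √(2 * b + ε))| := by
        rw [abs_mul, abs_of_nonneg (a := √(2 * a + ε) + √(2 * b + ε)) (by positivity)]
    _ = |2 * (a - b)| := by
        congr 1
        have e1 := Real.mul_self_sqrt (show 0 ≤ 2 * a + ε by linarith)
        have e2 := Real.mul_self_sqrt (show 0 ≤ 2 * b + ε by linarith)
        linear_combination e1 - e2
    _ ≤ 2 * |x - z| := by rw [abs_mul, abs_two]; gcongr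

end TruncSqrt

/-! ### Passage to the limit and existence of a connection. -/

/-- Compactness: solutions of the truncated and regularised phase-plane equations accumulate at a
solution of the truncated equation. -/
lemma exists_limit_phaseField_connection {g : ℝ → ℝ} {B G M R C : ℝ} (hM : 0 ≤ M)
    (hB₀ : 0 ≤ B) (hRB : 2 * R + 1 ≤ B ^ 2) (hg : Continuous g)
    (hG : ∀ t ∈ Icc 0 M, |g t| ≤ G) (hR : (C * B + G) * M ≤ R)
    {c : ℕ → ℝ} {y : ℕ → ℝ → ℝ} (hc : ∀ n, c n ∈ Icc 0 C) (hy0 : ∀ n, y n 0 = 0)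
    (hyM : ∀ n, y n M = 0)
    (hy : ∀ n, IsIntegralCurveOn (y n) (phaseField (truncSqrt R (1 / ((n : ℝ) + 1))) g (c n))
      (Icc 0 M)) :
    ∃ c' ∈ Icc 0 C, ∃ z : ℝ → ℝ, z 0 = 0 ∧ z M = 0 ∧ (∀ t ∈ Icc 0 M, z t ≤ R) ∧
      Continuous z ∧ ∀ t ∈ Icc 0 M, HasDerivAt z (phaseField (truncSqrt R 0) g c' t (z t)) t := by
  have hΛ : 0 ≤ C * B + G := by
    have h1 := (abs_nonneg _).trans (hG 0 ⟨le_rfl, hM⟩)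
    have h2 := mul_nonneg ((hc 0).1.trans (hc 0).2) hB₀
    linarith
  set h : ℕ → ℝ → ℝ := fun n => truncSqrt R (1 / ((n : ℝ) + 1)) with hh
  have hhB : ∀ n z, h n z ∈ Icc 0 B := fun n z =>
    truncSqrt_mem_Icc hB₀ hRB (div_le_one_of_le₀ (by simp) (by positivity))
  -- This constant comes from the bound on the field, hence is uniform in `n`.
  have hlip : ∀ n, LipschitzOnWith (C * B + G).toNNReal (y n) (Icc 0 M) := fun n => by
    refine Convex.lipschitzOnWith_of_nnnorm_hasDerivWithin_le (convex_Icc 0 M) (hy n)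
      fun t ht => ?_
    rw [← NNReal.coe_le_coe, coe_nnnorm, Real.coe_toNNReal _ hΛ]
    exact abs_phaseField_le (hhB n) hG (hc n) ht _
  set Z : ℕ → BoundedContinuousFunction (Icc 0 M) ℝ := fun n =>
    BoundedContinuousFunction.mkOfCompact ⟨(Icc 0 M).domRestrict (y n), (hy n).continuousOn.domRestrict⟩
    with hZ
  have hZlip : ∀ n, LipschitzWith (C * B + G).toNNReal (Z n) := fun n => (hlip n).to_restrict
  have hZmem : ∀ n t, Z n t ∈ Icc (-R) R := fun n t => by
    have h1 := (hZlip n).dist_le_mul t ⟨0, le_rfl, hM⟩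
    have h2 : Z n ⟨0, le_rfl, hM⟩ = 0 := hy0 n
    rw [h2, dist_zero_right, Real.norm_eq_abs, Real.coe_toNNReal _ hΛ, Subtype.dist_eq,
      Real.dist_eq, sub_zero, abs_of_nonneg t.2.1] at h1
    exact abs_le.1 (h1.trans ((mul_le_mul_of_nonneg_left t.2.2 hΛ).trans hR))
  have hcpt : IsCompact (closure (range Z)) := by
    refine BoundedContinuousFunction.arzela_ascoli (Icc (-R) R) isCompact_Icc _ ?_ ?_
    · rintro _ t ⟨n, rfl⟩
      exact hZmem n t
    · refine (LipschitzWith.uniformEquicontinuous _ (C * B + G).toNNReal ?_).equicontinuous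
      rintro ⟨_, n, rfl⟩
      exact hZlip n
  obtain ⟨⟨c', z⟩, hcz, ns, hns, hlim⟩ := (isCompact_Icc.prod hcpt).tendsto_subseq
    (x := fun n => (c n, Z n)) fun n => ⟨hc n, subset_closure (mem_range_self n)⟩
  have hclim : Tendsto (fun n => c (ns n)) atTop (𝓝 c') := (continuous_fst.tendsto _).comp hlim
  have hZlim : ∀ t, Tendsto (fun n => Z (ns n) t) atTop (𝓝 (z t)) := fun t =>
    ((continuous_eval_const t).tendsto z).comp ((continuous_snd.tendsto _).comp hlim)
  set w : ℝ → ℝ := fun t => z (projIcc 0 M hM t) with hw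
  have hwc : Continuous w := z.continuous.comp continuous_projIcc
  have hylim : ∀ t ∈ Icc 0 M, Tendsto (fun n => y (ns n) t) atTop (𝓝 (w t)) := fun t ht => by
    simp only [hw, projIcc_of_mem hM ht]
    exact hZlim ⟨t, ht⟩
  have hfc : Continuous fun s => phaseField (truncSqrt R 0) g c' s (w s) :=
    (((continuous_truncSqrt R 0).comp hwc).const_mul c').sub hg
  have hweq : ∀ t ∈ Icc 0 M, w t = ∫ s in (0 : ℝ)..t, phaseField (truncSqrt R 0) g c' s (w s) := by
    intro t ht
    refine tendsto_nhds_unique (hylim t ht) ?_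
    have hsub : uIoc 0 t ⊆ Icc 0 M := by
      rw [uIoc_of_le ht.1]
      exact Ioc_subset_Icc_self.trans (Icc_subset_Icc_right ht.2)
    have hconv : Tendsto (fun n => ∫ s in (0 : ℝ)..t, phaseField (h (ns n)) g (c (ns n)) s
        (y (ns n) s)) atTop (𝓝 (∫ s in (0 : ℝ)..t, phaseField (truncSqrt R 0) g c' s (w s))) := by
      refine intervalIntegral.tendsto_integral_filter_of_dominated_convergence
        (fun _ => C * B + G) (Eventually.of_forall fun n => ?_)
        (Eventually.of_forall fun n => ?_) intervalIntegrable_const ?_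
      · refine ContinuousOn.aestronglyMeasurable ?_ measurableSet_uIoc
        exact (((continuous_truncSqrt R (1 / ((ns n : ℝ) + 1))).comp_continuousOn
          ((hy (ns n)).continuousOn.mono hsub)).const_smul (c (ns n))).sub hg.continuousOn
      · exact Eventually.of_forall fun s hs =>
          abs_phaseField_le (hhB (ns n)) hG (hc (ns n)) (hsub hs) _
      · refine Eventually.of_forall fun s hs => ?_
        have hε : Tendsto (fun n => 1 / ((ns n : ℝ) + 1)) atTop (𝓝 0) :=
          tendsto_one_div_add_atTop_nhds_zero_nat.comp hns.tendsto_atTop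
        have hcont : Continuous fun q : ℝ × ℝ => truncSqrt R q.1 q.2 := by
          unfold truncSqrt; fun_prop
        exact (hclim.mul ((hcont.tendsto (0, w s)).comp
          (hε.prodMk_nhds (hylim s (hsub hs))))).sub_const (g s)
    exact hconv.congr fun n =>
      ((hy (ns n)).eq_integral (continuous_truncSqrt R _) hg (hy0 _) ht).symm
  have hM' : M ∈ Icc 0 M := ⟨hM, le_rfl⟩
  -- `v` equals `w` on `[0, M]`, but as an integral it also has two-sided derivatives at the
  -- endpoints.
  set v : ℝ → ℝ := fun t => ∫ s in (0 : ℝ)..t, phaseField (truncSqrt R 0) g c' s (w s) with hv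
  have hv' : ∀ t, HasDerivAt v (phaseField (truncSqrt R 0) g c' t (w t)) t := fun t =>
    intervalIntegral.integral_hasDerivAt_right (hfc.intervalIntegrable _ _)
      hfc.stronglyMeasurable.stronglyMeasurableAtFilter hfc.continuousAt
  refine ⟨c', hcz.1, v, by simp [hv], ?_, fun t ht => ?_,
    continuous_iff_continuousAt.2 fun t => (hv' t).continuousAt, fun t ht => ?_⟩
  · exact (hweq M hM').symm.trans (tendsto_nhds_unique (hylim M hM') (by simp [hyM]))
  · exact (hweq t ht).symm.trans_le
      (le_of_tendsto' (hylim t ht) fun n => (hZmem (ns n) ⟨t, ht⟩).2)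
  · exact (hv' t).congr_deriv (by rw [hweq t ht])

/-- For `c ≥ 0` any shot satisfies `y ≥ -F`, so `∫ h(y)` over `[0, M]` is at least `I > 0` uniformly
in `ε`. This makes `C = F(M) / I` an upper endpoint for the shooting that does not depend on `ε`. -/
lemma IsBistable.exists_truncated_connection {g : ℝ → ℝ} {m M : ℝ} (hg : IsBistable g m M) :
    ∃ R, 0 ≤ R ∧ ∃ c, 0 ≤ c ∧ ∃ z : ℝ → ℝ, z 0 = 0 ∧ z M = 0 ∧ (∀ t ∈ Icc 0 M, z t ≤ R) ∧
      Continuous z ∧ ∀ t ∈ Icc 0 M, HasDerivAt z (phaseField (truncSqrt R 0) g c t (z t)) t := by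
  obtain ⟨G, hG⟩ := (isCompact_Icc (a := 0) (b := M)).exists_bound_of_continuousOn
    hg.cont.continuousOn
  simp only [Real.norm_eq_abs] at hG
  have hM := hg.pos_M
  have hm := hg.pos_m
  have hG0 : 0 ≤ G := (abs_nonneg _).trans (hG 0 ⟨le_rfl, hM.le⟩)
  set F : ℝ → ℝ := fun s => ∫ σ in (0 : ℝ)..s, g σ with hF
  have hFM : 0 < F M := hg.primitive_pos
  have hFc : Continuous F :=
    continuous_iff_continuousAt.2 fun u => (hg.hasDerivAt_primitive u).continuousAt
  have hsc : Continuous fun s => √(2 * -F s) := by fun_prop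
  set I := ∫ s in (0 : ℝ)..m, √(2 * -F s) with hI
  have hIpos : 0 < I :=
    intervalIntegral.intervalIntegral_pos_of_pos_on (hsc.intervalIntegrable _ _)
      (fun s hs => Real.sqrt_pos.2 (by linarith [hg.primitive_neg s (Ioo_subset_Ioc_self hs)])) hm
  set C := F M / I with hC
  have hC0 : 0 ≤ C := by positivity
  -- `B` bounds the square root and `R` bounds `y`. Since `R` is quadratic in `B` while `(C * B + G)
  -- * M` is linear, a large `B` keeps the shots below the truncation.
  set B := 2 * M * C + 2 * M * G + 1 with hB
  have hB1 : 1 ≤ B := by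
    have : 0 ≤ 2 * M * C + 2 * M * G := by positivity
    linarith
  set R := (B ^ 2 - 1) / 2 with hRdef
  have hR0 : 0 ≤ R := by
    have : 1 ≤ B ^ 2 := one_le_pow₀ hB1
    linarith
  have hRM : (C * B + G) * M ≤ R := by
    have : 0 ≤ (2 * M * G + 1) * (B - 1) := mul_nonneg (by positivity) (by linarith)
    nlinarith
  have hRB : 2 * R + 1 ≤ B ^ 2 := by linarith
  have hex : ∀ n : ℕ, ∃ c ∈ Icc 0 C, ∃ y : ℝ → ℝ, y 0 = 0 ∧ y M = 0 ∧
      IsIntegralCurveOn y (phaseField (truncSqrt R (1 / ((n : ℝ) + 1))) g c) (Icc 0 M) := by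
    intro n
    set ε := 1 / ((n : ℝ) + 1) with hε
    have hε0 : 0 < ε := by positivity
    have hε1 : ε ≤ 1 := div_le_one_of_le₀ (by simp) (by positivity)
    have hhB : ∀ z, truncSqrt R ε z ∈ Icc 0 B := fun z =>
      truncSqrt_mem_Icc (by linarith) hRB hε1
    refine exists_phaseField_connection hM.le hC0 (lipschitzWith_truncSqrt hR0 hε0) hhB hg.cont hG
      hFM.le fun y hy0 hy => ?_
    have hcy : ∀ t ∈ Icc 0 M, ContinuousOn (fun s => truncSqrt R ε (y s)) (uIcc 0 t) :=
      fun t ht => by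
        rw [uIcc_of_le ht.1]
        exact (continuous_truncSqrt R ε).comp_continuousOn
          (hy.continuousOn.mono (Icc_subset_Icc_right ht.2))
    have hyt : ∀ t ∈ Icc 0 M, y t = C * (∫ s in (0 : ℝ)..t, truncSqrt R ε (y s)) - F t :=
      fun t ht => by
        rw [hy.eq_integral (continuous_truncSqrt R ε) hg.cont hy0 ht]
        simp only [phaseField]
        rw [intervalIntegral.integral_sub ((hcy t ht).intervalIntegrable.const_mul C)
          (hg.cont.intervalIntegrable _ _), intervalIntegral.integral_const_mul]
    have hylow : ∀ t ∈ Icc 0 M, -F t ≤ y t := fun t ht => by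
      have : 0 ≤ ∫ s in (0 : ℝ)..t, truncSqrt R ε (y s) :=
        intervalIntegral.integral_nonneg ht.1 fun s _ => (hhB _).1
      rw [hyt t ht]
      nlinarith
    have hFR : ∀ t ∈ Icc 0 M, -F t ≤ R := fun t ht => by
      have h1 : ‖∫ s in (0 : ℝ)..t, g s‖ ≤ G * |t - 0| := intervalIntegral.norm_integral_le_of_norm_le_const
        fun s hs => hG s (by
          rw [uIoc_of_le ht.1] at hs
          exact ⟨hs.1.le, hs.2.trans ht.2⟩)
      rw [sub_zero, abs_of_nonneg ht.1, Real.norm_eq_abs] at h1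
      have h2 : G * t ≤ G * M := mul_le_mul_of_nonneg_left ht.2 hG0
      have h3 : 0 ≤ C * B * M := by positivity
      have h4 : -F t ≤ |F t| := neg_le_abs _
      linarith
    have hmM : m ∈ Icc 0 M := ⟨hm.le, hg.m_lt.le⟩
    have hMM : M ∈ Icc 0 M := ⟨hM.le, le_rfl⟩
    have hint := (hcy M hMM).intervalIntegrable (μ := MeasureTheory.volume)
    have h1 : I ≤ ∫ s in (0 : ℝ)..m, truncSqrt R ε (y s) :=
      intervalIntegral.integral_mono_on hm.le (hsc.intervalIntegrable _ _)
        (hcy m hmM).intervalIntegrable fun s hs =>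
          have hs' : s ∈ Icc 0 M := ⟨hs.1, hs.2.trans hg.m_lt.le⟩
          sqrt_le_truncSqrt hε0.le (hylow s hs') (hFR s hs')
    have h2 : (∫ s in (0 : ℝ)..m, truncSqrt R ε (y s)) ≤ ∫ s in (0 : ℝ)..M, truncSqrt R ε (y s) :=
      intervalIntegral.integral_mono_interval le_rfl hm.le hg.m_lt.le
        (Eventually.of_forall fun s => (hhB _).1) hint
    rw [hyt M hMM]
    have h3 : C * I = F M := by rw [hC]; field_simp
    nlinarith [mul_le_mul_of_nonneg_left (h1.trans h2) hC0]
  choose c hc y hy0 hyM hy using hex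
  obtain ⟨c', hc', z, hz⟩ := exists_limit_phaseField_connection hM.le (by linarith) hRB hg.cont hG
    hRM hc hy0 hyM hy
  exact ⟨R, hR0, c', hc'.1, z, hz⟩

/-- The phase-plane equation has a solution connecting `0` and `M`. -/
lemma IsBistable.exists_connection {g : ℝ → ℝ} {m M : ℝ} (hg : IsBistable g m M) :
    ∃ c, 0 < c ∧ ∃ y : ℝ → ℝ, Continuous y ∧ y 0 = 0 ∧ y M = 0 ∧ (∀ u ∈ Ioo 0 M, 0 < y u) ∧
      ∀ u ∈ Icc 0 M, HasDerivAt y (c * √(2 * y u) - g u) u := by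
  obtain ⟨R, hR, c, hc, y, hy0, hyM, hyR, hyc, hy⟩ := hg.exists_truncated_connection
  have hM := hg.pos_M
  have h0mem : (0 : ℝ) ∈ Icc 0 M := ⟨le_rfl, hM.le⟩
  have hMmem : M ∈ Icc 0 M := ⟨hM.le, le_rfl⟩
  -- `y + F` is nondecreasing, so `y ≥ -F > 0` on `(0, m]`.
  have hd : ∀ t ∈ Icc 0 M,
      HasDerivAt (fun t => y t + ∫ s in (0 : ℝ)..t, g s) (c * truncSqrt R 0 (y t)) t :=
    fun t ht => ((hy t ht).add (hg.hasDerivAt_primitive t)).congr_deriv (by simp [phaseField])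
  have hmono : MonotoneOn (fun t => y t + ∫ s in (0 : ℝ)..t, g s) (Icc 0 M) := by
    refine monotoneOn_of_deriv_nonneg (convex_Icc 0 M)
      (fun t ht => (hd t ht).continuousAt.continuousWithinAt)
      (fun t ht => (hd t (interior_subset ht)).differentiableAt.differentiableWithinAt)
      fun t ht => ?_
    rw [(hd t (interior_subset ht)).deriv]
    exact mul_nonneg hc (Real.sqrt_nonneg _)
  have hpos : ∀ u ∈ Ioo 0 M, 0 < y u := fun u hu => by
    rcases le_or_gt u m with hum | hum
    · have h1 := hmono h0mem (Ioo_subset_Icc_self hu) hu.1.le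
      have h2 := hg.primitive_neg u ⟨hu.1, hum⟩
      simp only [hy0, intervalIntegral.integral_same, add_zero] at h1
      linarith
    -- Beyond `m`, `y' = -g < 0` wherever `y ≤ 0`: once nonpositive, `y` would decrease strictly up
    -- to `M`, against `y M = 0`.
    · by_contra! hyu
      have hgpos : ∀ t ∈ Ico u M, 0 < g t := fun t ht => hg.pos t ⟨hum.trans_le ht.1, ht.2⟩
      have hsub : ∀ t ∈ Icc u M, t ∈ Icc 0 M := fun t ht => ⟨hu.1.le.trans ht.1, ht.2⟩
      have hle : ∀ t ∈ Icc u M, y t ≤ 0 :=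
        image_le_of_deriv_right_lt_deriv_boundary (B := fun _ => 0) (B' := fun _ => 0)
          hyc.continuousOn (fun t ht => (hy t (hsub t (Ico_subset_Icc_self ht))).hasDerivWithinAt)
          hyu (fun t => hasDerivAt_const t 0)
          fun t ht hyt => by
            rw [phaseField, truncSqrt_zero_of_nonpos hR hyt.le]
            linarith [hgpos t ht]
      have hanti : StrictAntiOn y (Icc u M) := by
        refine strictAntiOn_of_deriv_neg (convex_Icc u M) hyc.continuousOn fun t ht => ?_
        rw [interior_Icc] at ht
        rw [(hy t (hsub t (Ioo_subset_Icc_self ht))).deriv, phaseField,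
          truncSqrt_zero_of_nonpos hR (hle t (Ioo_subset_Icc_self ht))]
        linarith [hgpos t (Ioo_subset_Ico_self ht)]
      have := hanti ⟨le_rfl, hu.2.le⟩ ⟨hu.2.le, le_rfl⟩ hu.2
      linarith
  have hnonneg : ∀ u ∈ Icc 0 M, 0 ≤ y u := fun u hu => by
    rcases hu.1.eq_or_lt with rfl | h0
    · exact hy0.ge
    rcases hu.2.eq_or_lt with rfl | h1
    · exact hyM.ge
    exact (hpos u ⟨h0, h1⟩).le
  refine ⟨c, hc.lt_of_ne ?_, y, hyc, hy0, hyM, hpos, fun u hu => ?_⟩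
  -- With `c = 0`, `y + F` would be constant, against `F M > 0`.
  · rintro rfl
    have := constant_of_has_deriv_right_zero
      (fun t ht => (hd t ht).continuousAt.continuousWithinAt)
      (fun t ht => by simpa using (hd t (Ico_subset_Icc_self ht)).hasDerivWithinAt) M hMmem
    simp only [hy0, hyM, intervalIntegral.integral_same, add_zero, zero_add] at this
    exact hg.primitive_pos.ne' this
  · have := hy u hu
    rwa [phaseField, truncSqrt_zero_of_mem ⟨hnonneg u hu, hyR u hu⟩] at this

/-- The phase-plane equation has a solution vanishing linearly at `0` and `M`. -/
theorem IsBistable.exists_isPhaseProfile {g : ℝ → ℝ} {m M : ℝ} (hg : IsBistable g m M) :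
    ∃ c, 0 < c ∧ ∃ p, IsPhaseProfile g M c p ∧ ∃ A, 0 < A ∧
      (∀ u ∈ Ioo 0 M, p u ≤ A * u) ∧ ∀ u ∈ Ioo 0 M, p u ≤ A * (M - u) := by
  obtain ⟨c, hc, y, hyc, hy0, hyM, hpos, hy⟩ := hg.exists_connection
  obtain ⟨L, hL⟩ := hg.lipschitz
  have hM := hg.pos_M
  have hL0 : 0 ≤ L := by
    have := (abs_nonneg _).trans (hL M ⟨hM.le, le_rfl⟩).1
    exact nonneg_of_mul_nonneg_left this hM
  set A := c + L + 1 with hA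
  have hA0 : 0 < A := by positivity
  refine ⟨c, hc, fun u => √(2 * y u), ⟨by fun_prop, by simp [hy0], by simp [hyM],
    fun u hu => Real.sqrt_pos.2 (by linarith [hpos u hu]), fun u hu => ?_⟩, A, hA0,
    fun u hu => ?_, fun u hu => ?_⟩
  · have hyu : 0 < 2 * y u := by linarith [hpos u hu]
    refine (((hy u (Ioo_subset_Icc_self hu)).const_mul 2).sqrt hyu.ne').congr_deriv ?_
    have := (Real.sqrt_pos.2 hyu).ne'
    field_simp
  -- As `A² > c A + L`, the parabola `A² (t + η)² / 2` is a strict supersolution; the shift `η`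
  -- keeps the inequality strict at `t = 0`.
  · have key : ∀ η > 0, √(2 * y u) ≤ A * (u + η) := fun η hη => by
      have h1 : y u ≤ A ^ 2 * (u + η) ^ 2 / 2 := by
        refine image_le_of_deriv_right_lt_deriv_boundary (a := 0) (b := M)
          (B := fun t => A ^ 2 * (t + η) ^ 2 / 2) (B' := fun t => A ^ 2 * (t + η))
          hyc.continuousOn (fun t ht => (hy t (Ico_subset_Icc_self ht)).hasDerivWithinAt)
          (by rw [hy0]; positivity) (fun t => ?_) (fun t ht hyt => ?_) (Ioo_subset_Icc_self hu)
        · exact ((((hasDerivAt_id t).add_const η).pow 2).const_mul (A ^ 2) |>.div_const 2).congr_deriv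
            (by simp; ring)
        · have htη : 0 < t + η := by linarith [ht.1]
          have h2 : √(2 * y t) = A * (t + η) := by
            rw [hyt, show 2 * (A ^ 2 * (t + η) ^ 2 / 2) = (A * (t + η)) ^ 2 by ring,
              Real.sqrt_sq (by positivity)]
          have h3 := (abs_le.1 (hL t (Ico_subset_Icc_self ht)).1).1
          have h4 : L * t ≤ L * (t + η) := by nlinarith
          rw [h2]
          have h5 : c * A + L < A ^ 2 := by nlinarith
          nlinarith
      rw [show A * (u + η) = √((A * (u + η)) ^ 2) from
        (Real.sqrt_sq (mul_nonneg hA0.le (by linarith [hu.1]))).symm]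
      exact Real.sqrt_le_sqrt (by nlinarith)
    have hlim : Tendsto (fun η => A * (u + η)) (𝓝[>] 0) (𝓝 (A * (u + 0))) :=
      (Continuous.tendsto (by fun_prop) 0).mono_left nhdsWithin_le_nhds
    rw [add_zero] at hlim
    exact ge_of_tendsto hlim (eventually_mem_nhdsWithin.mono fun η hη => key η hη)
  -- Here `g ≤ L (M - t)` and `c√(2y) ≥ 0` suffice: the difference is nondecreasing and vanishes at
  -- `M`.
  · have hmono : MonotoneOn (fun t => y t - L * (M - t) ^ 2 / 2) (Icc 0 M) := by
      have hd : ∀ t ∈ Icc 0 M, HasDerivAt (fun t => y t - L * (M - t) ^ 2 / 2)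
          (c * √(2 * y t) - g t + L * (M - t)) t := fun t ht =>
        ((hy t ht).sub (((((hasDerivAt_id t).const_sub M).pow 2).const_mul L).div_const 2)).congr_deriv
          (by simp; ring)
      refine monotoneOn_of_deriv_nonneg (convex_Icc 0 M)
        (fun t ht => (hd t ht).continuousAt.continuousWithinAt)
        (fun t ht => (hd t (interior_subset ht)).differentiableAt.differentiableWithinAt)
        fun t ht => ?_
      have ht := interior_subset ht
      rw [(hd t ht).deriv]
      have h1 := (abs_le.1 (hL t ht).2).2
      have h2 := mul_nonneg hc.le (Real.sqrt_nonneg (2 * y t))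
      linarith
    have h1 := hmono (Ioo_subset_Icc_self hu) ⟨hM.le, le_rfl⟩ hu.2.le
    simp only [hyM, sub_self] at h1
    have hMu : 0 < M - u := sub_pos.2 hu.2
    rw [show A * (M - u) = √((A * (M - u)) ^ 2) from (Real.sqrt_sq (by positivity)).symm]
    refine Real.sqrt_le_sqrt ?_
    have hLA : L ≤ A ^ 2 := by nlinarith
    have := mul_le_mul_of_nonneg_right hLA (sq_nonneg (M - u))
    nlinarith

/-! ### From a phase profile to a front. -/

namespace IsPhaseProfile

variable {g p : ℝ → ℝ} {M c : ℝ}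

/-- A phase profile vanishing at most linearly at `0` and `M` generates a front, to which any other
solution of `ψ' = -p ∘ ψ` reduces by a shift. -/
theorem exists_isFront (hp : IsPhaseProfile g M c p) (hg : Continuous g) (hM : 0 < M) {A : ℝ}
    (hA : 0 < A) (hA₀ : ∀ u ∈ Ioo 0 M, p u ≤ A * u) (hA₁ : ∀ u ∈ Ioo 0 M, p u ≤ A * (M - u)) :
    ∃ φ, IsFront g M c φ ∧ ∀ ψ : ℝ → ℝ, (∀ x, ψ x ∈ Ioo 0 M) →
      (∀ x, HasDerivAt ψ (-p (ψ x)) x) → ∃ τ, ∀ x, ψ x = φ (x + τ) := by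
  have hmid : M / 2 ∈ Ioo 0 M := ⟨by linarith, by linarith⟩
  -- `T u` is the time at which the front is at level `u`, normalised by `T (M / 2) = 0`; the front
  -- is its inverse.
  set T : ℝ → ℝ := fun u => ∫ s in (M / 2)..u, -(p s)⁻¹ with hT
  have hcont : ContinuousOn (fun s => -(p s)⁻¹) (Ioo 0 M) :=
    (hp.cont.continuousOn.inv₀ fun u hu => (hp.pos u hu).ne').neg
  have hT' : ∀ u ∈ Ioo 0 M, HasDerivAt T (-(p u)⁻¹) u := fun u hu =>
    intervalIntegral.integral_hasDerivAt_right
      (hcont.mono (ordConnected_Ioo.uIcc_subset hmid hu)).intervalIntegrable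
      (hcont.stronglyMeasurableAtFilter isOpen_Ioo u hu) (hcont.continuousAt (Ioo_mem_nhds hu.1 hu.2))
  have hTc : ContinuousOn T (Ioo 0 M) := fun u hu => (hT' u hu).continuousAt.continuousWithinAt
  have hTanti : StrictAntiOn T (Ioo 0 M) :=
    strictAntiOn_of_deriv_neg (convex_Ioo 0 M) hTc fun u hu => by
      rw [interior_Ioo] at hu
      rw [(hT' u hu).deriv, neg_lt_zero]
      exact inv_pos.2 (hp.pos u hu)
  -- The linear bounds on `p` compare `T` with logarithms, so `T` is unbounded at both ends and onto
  -- `ℝ`.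
  have hlog₀ : AntitoneOn (fun u => T u + Real.log u / A) (Ioo 0 M) := by
    have hd : ∀ u ∈ Ioo 0 M, HasDerivAt (fun u => T u + Real.log u / A) (-(p u)⁻¹ + u⁻¹ / A) u :=
      fun u hu => (hT' u hu).add ((Real.hasDerivAt_log hu.1.ne').div_const A)
    refine antitoneOn_of_deriv_nonpos (convex_Ioo 0 M)
      (fun u hu => (hd u hu).continuousAt.continuousWithinAt)
      (fun u hu => (hd u (interior_subset hu)).differentiableAt.differentiableWithinAt)
      fun u hu => ?_
    have hu := interior_subset hu
    rw [(hd u hu).deriv, inv_div_left]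
    linarith [inv_anti₀ (hp.pos u hu) (hA₀ u hu)]
  have hlog₁ : AntitoneOn (fun u => T u - Real.log (M - u) / A) (Ioo 0 M) := by
    have hd : ∀ u ∈ Ioo 0 M,
        HasDerivAt (fun u => T u - Real.log (M - u) / A) (-(p u)⁻¹ - -1 / (M - u) / A) u :=
      fun u hu => (hT' u hu).sub ((((hasDerivAt_id u).const_sub M).log
        (sub_pos.2 hu.2).ne').div_const A)
    refine antitoneOn_of_deriv_nonpos (convex_Ioo 0 M)
      (fun u hu => (hd u hu).continuousAt.continuousWithinAt)
      (fun u hu => (hd u (interior_subset hu)).differentiableAt.differentiableWithinAt)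
      fun u hu => ?_
    have hu := interior_subset hu
    rw [(hd u hu).deriv, div_div, neg_div, one_div, mul_comm]
    linarith [inv_anti₀ (hp.pos u hu) (hA₁ u hu)]
  have hsurj : ∀ x, ∃ u ∈ Ioo 0 M, T u = x := fun x => by
    obtain ⟨a, ha, hxa⟩ : ∃ a ∈ Ioo 0 M, x ≤ T a := by
      have h1 : ∀ᶠ u in 𝓝[>] (0 : ℝ), Real.log u ≤ A * (T (M / 2) - x) + Real.log (M / 2) :=
        Real.tendsto_log_nhdsGT_zero.eventually (eventually_le_atBot _)
      obtain ⟨u, hu, hu1⟩ := (h1.and (Ioo_mem_nhdsGT hmid.1)).exists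
      have huM : u ∈ Ioo 0 M := ⟨hu1.1, hu1.2.trans hmid.2⟩
      refine ⟨u, huM, ?_⟩
      have h2 := hlog₀ huM hmid hu1.2.le
      have h3 : Real.log u / A ≤ T (M / 2) - x + Real.log (M / 2) / A := by
        rw [div_le_iff₀ hA]; field_simp; linarith
      simp only at h2
      linarith
    obtain ⟨b, hb, hxb⟩ : ∃ b ∈ Ioo 0 M, T b ≤ x := by
      have h1 : ∀ᶠ u in 𝓝[>] (0 : ℝ), Real.log u ≤ A * (x - T (M / 2)) + Real.log (M / 2) :=
        Real.tendsto_log_nhdsGT_zero.eventually (eventually_le_atBot _)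
      obtain ⟨u, hu, hu1⟩ := (h1.and (Ioo_mem_nhdsGT hmid.1)).exists
      have huM : M - u ∈ Ioo 0 M := ⟨by linarith [hu1.2], by linarith [hu1.1]⟩
      refine ⟨M - u, huM, ?_⟩
      have h2 := hlog₁ hmid huM (by linarith [hu1.2])
      have h3 : Real.log u / A ≤ x - T (M / 2) + Real.log (M / 2) / A := by
        rw [div_le_iff₀ hA]; field_simp; linarith
      simp only [sub_sub_cancel, sub_half] at h2
      linarith
    obtain ⟨u, hu, hux⟩ := (convex_Ioo 0 M).isPreconnected.intermediate_value hb ha hTc ⟨hxb, hxa⟩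
    exact ⟨u, hu, hux⟩
  choose φ hφ hTφ using hsurj
  have hφT : ∀ u ∈ Ioo 0 M, φ (T u) = u := fun u hu => hTanti.injOn (hφ _) hu (hTφ _)
  have hanti : StrictAnti φ := fun x y hxy => by
    rw [← hTanti.lt_iff_gt (hφ x) (hφ y), hTφ, hTφ]
    exact hxy
  have hφc : Continuous φ := by
    have hmono : Monotone fun x => (⟨φ (-x), hφ (-x)⟩ : Ioo 0 M) := fun x y hxy =>
      Subtype.mk_le_mk.2 (hanti.antitone (neg_le_neg hxy))
    have := hmono.continuous_of_surjective fun u =>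
      ⟨-T u, Subtype.ext (by simpa using hφT u u.2)⟩
    simpa [Function.comp_def] using (continuous_subtype_val.comp this).comp continuous_neg
  have hφ' : ∀ x, HasDerivAt φ (-p (φ x)) x := fun x => by
    have := HasDerivAt.of_local_left_inverse hφc.continuousAt (hT' _ (hφ x))
      (neg_ne_zero.2 (inv_pos.2 (hp.pos _ (hφ x))).ne') (Eventually.of_forall hTφ)
    rwa [inv_neg, inv_inv] at this
  have hderiv : deriv φ = fun x => -p (φ x) := funext fun x => (hφ' x).deriv
  have hφ'' : ∀ x, HasDerivAt (deriv φ) (c * p (φ x) - g (φ x)) x := fun x => by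
    rw [hderiv]
    refine (((hp.hasDerivAt _ (hφ x)).comp x (hφ' x)).neg).congr_deriv ?_
    have := (hp.pos _ (hφ x)).ne'
    field_simp
  refine ⟨φ, ⟨?_, hφ, fun x => ?_, ?_, ?_⟩, fun ψ hψ hψ' => ?_⟩
  · refine (contDiff_succ_iff_deriv (n := 1)).2
      ⟨fun x => (hφ' x).differentiableAt, by simp, contDiff_one_iff_deriv.2
        ⟨fun x => (hφ'' x).differentiableAt, ?_⟩⟩
    rw [show deriv (deriv φ) = fun x => c * p (φ x) - g (φ x) from funext fun x => (hφ'' x).deriv]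
    exact ((hp.cont.comp hφc).const_mul c).sub (hg.comp hφc)
  · rw [(hφ'' x).deriv, (hφ' x).deriv]
    ring
  · refine tendsto_order.2 ⟨fun a ha => ?_, fun a ha => Eventually.of_forall fun x =>
      (hφ x).2.trans ha⟩
    have hu : max a (M / 2) ∈ Ioo 0 M := ⟨lt_max_of_lt_right hmid.1, max_lt ha hmid.2⟩
    filter_upwards [eventually_lt_atBot (T (max a (M / 2)))] with x hx
    calc a ≤ max a (M / 2) := le_max_left _ _
      _ = φ (T (max a (M / 2))) := (hφT _ hu).symm
      _ < φ x := hanti hx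
  · refine tendsto_order.2 ⟨fun a ha => Eventually.of_forall fun x => ha.trans (hφ x).1,
      fun a ha => ?_⟩
    have hu : min a (M / 2) ∈ Ioo 0 M := ⟨lt_min ha hmid.1, min_lt_of_right_lt hmid.2⟩
    filter_upwards [eventually_gt_atTop (T (min a (M / 2)))] with x hx
    calc φ x < φ (T (min a (M / 2))) := hanti hx
      _ = min a (M / 2) := hφT _ hu
      _ ≤ a := min_le_left _ _
  -- Along `ψ` the time `T` runs at unit speed; the shift is its value at `x = 0`.
  · have h1 : ∀ x, HasDerivAt (fun x => T (ψ x) - x) 0 x := fun x => by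
      refine (((hT' _ (hψ x)).comp x (hψ' x)).sub (hasDerivAt_id x)).congr_deriv ?_
      have := (hp.pos _ (hψ x)).ne'
      field_simp
      ring
    refine ⟨T (ψ 0), fun x => hTanti.injOn (hψ x) (hφ _) ?_⟩
    have := is_const_of_deriv_eq_zero (fun x => (h1 x).differentiableAt) (fun x => (h1 x).deriv) x 0
    rw [hTφ]
    linarith

end IsPhaseProfile

/-! ### Extension of the reaction term and conclusion. -/

/-- The continuous extension of a bistable nonlinearity of class `C¹` on `[0, M]`. -/
lemma isBistable_IccExtend {m M : ℝ} (hm : 0 < m) (hmM : m < M) (hM : 0 ≤ M)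
    {f : ℝ → ℝ} (hf : ContDiffOn ℝ 1 f (Icc 0 M)) (hf0 : f 0 = 0) (hfM : f M = 0)
    (hf'0 : derivWithin f (Icc 0 M) 0 < 0) (hfpos : ∀ s ∈ Ioo m M, 0 < f s)
    (hFneg : ∀ s ∈ Ioc 0 m, (∫ σ in (0 : ℝ)..s, f σ) < 0)
    (hFM : 0 < ∫ σ in (0 : ℝ)..M, f σ) :
    IsBistable (IccExtend hM ((Icc 0 M).domRestrict f)) m M := by
  have hM' : 0 < M := hm.trans hmM
  have heq : ∀ s ∈ Icc 0 M, IccExtend hM ((Icc 0 M).domRestrict f) s = f s := fun s hs =>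
    IccExtend_of_mem hM _ hs
  have hint : ∀ s ∈ Icc 0 M, (∫ σ in (0 : ℝ)..s, IccExtend hM ((Icc 0 M).domRestrict f) σ) =
      ∫ σ in (0 : ℝ)..s, f σ := fun s hs =>
    intervalIntegral.integral_congr fun σ hσ => by
      rw [uIcc_of_le hs.1] at hσ
      exact heq σ ⟨hσ.1, hσ.2.trans hs.2⟩
  have h0 : (0 : ℝ) ∈ Icc 0 M := ⟨le_rfl, hM⟩
  have hMM : M ∈ Icc 0 M := ⟨hM, le_rfl⟩
  refine ⟨hf.continuousOn.domRestrict.Icc_extend', hm, hmM, by rw [heq 0 h0, hf0],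
    by rw [heq M hMM, hfM], fun s hs => ?_, fun s hs => ?_, by rwa [hint M hMM], ?_, ?_⟩
  · rw [heq s ⟨(hm.trans hs.1).le, hs.2.le⟩]
    exact hfpos s hs
  · rw [hint s ⟨hs.1.le, hs.2.trans hmM.le⟩]
    exact hFneg s hs
  · have hd := ((hf.differentiableOn (by norm_num)) 0 h0).hasDerivWithinAt
    have hd' : HasDerivWithinAt f (derivWithin f (Icc 0 M) 0) (Ioi 0) 0 :=
      hd.mono_of_mem_nhdsWithin (mem_of_superset (Ioo_mem_nhdsGT hM') Ioo_subset_Icc_self)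
    have hs := (hasDerivWithinAt_iff_tendsto_slope' self_notMem_Ioi).1 hd'
    filter_upwards [hs.eventually (gt_mem_nhds hf'0), Ioo_mem_nhdsGT hM'] with s hs hsM
    rw [heq s (Ioo_subset_Icc_self hsM)]
    rw [slope_def_field, hf0, sub_zero, sub_zero] at hs
    exact (div_neg_iff.1 hs).resolve_left (fun h => absurd h.2 (not_lt.2 hsM.1.le)) |>.1
  · obtain ⟨K, hK⟩ := (hf.locallyLipschitzOn (convex_Icc 0 M)).exists_lipschitzOnWith_of_compact
      isCompact_Icc
    refine ⟨K, fun s hs => ?_⟩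
    rw [heq s hs]
    have h1 := hK.dist_le_mul s hs 0 h0
    have h2 := hK.dist_le_mul s hs M hMM
    rw [hf0, Real.dist_eq, Real.dist_eq, sub_zero, sub_zero, abs_of_nonneg hs.1] at h1
    rw [hfM, Real.dist_eq, Real.dist_eq, sub_zero, abs_sub_comm s M,
      abs_of_nonneg (sub_nonneg.2 hs.2)] at h2
    exact ⟨h1, h2⟩

theorem lemma3p1 (m M : ℝ) (hm : 0 < m) (hmM : m < M)
    (f : ℝ → ℝ) (hf : ContDiffOn ℝ 1 f (Icc 0 M))
    (hf0 : f 0 = 0) (hfM : f M = 0)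
    (hf'0 : derivWithin f (Icc 0 M) 0 < 0)
    (hfpos : ∀ s ∈ Ioo m M, 0 < f s)
    (hFneg : ∀ s ∈ Ioc 0 m, (∫ σ in (0 : ℝ)..s, f σ) < 0)
    (hFM : 0 < ∫ σ in (0 : ℝ)..M, f σ) :
    ∃ (c : ℝ) (φ : ℝ → ℝ), IsFront f M c φ ∧
      (∀ (c' : ℝ) (ψ : ℝ → ℝ), IsFront f M c' ψ →
        c' = c ∧ ∃ τ : ℝ, ∀ x, ψ x = φ (x + τ)) ∧
      0 < c ∧ ∀ x, deriv φ x < 0 := by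
  have hM : 0 ≤ M := (hm.trans hmM).le
  have hg := isBistable_IccExtend hm hmM hM hf hf0 hfM hf'0 hfpos hFneg hFM
  have heq : ∀ s ∈ Ioo 0 M, IccExtend hM ((Icc 0 M).domRestrict f) s = f s := fun s hs =>
    IccExtend_of_mem hM _ (Ioo_subset_Icc_self hs)
  obtain ⟨c, hc, p, hp, A, hA, hA₀, hA₁⟩ := hg.exists_isPhaseProfile
  obtain ⟨φ, hφ, hshift⟩ := hp.exists_isFront hg.cont hg.pos_M hA hA₀ hA₁
  refine ⟨c, φ, hφ.congr heq, fun c' ψ hψ => ?_, hc, hφ.deriv_neg hg⟩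
  have hψ' := hψ.congr fun s hs => (heq s hs).symm
  obtain ⟨hcc, hd⟩ := hψ'.eq_of_isPhaseProfile hg hp
  exact ⟨hcc, hshift ψ hψ.mem_Ioo fun x => by rw [← hd x]; exact hψ.hasDerivAt x⟩
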